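/- **Model.** Let $\mathcal A$ be a finite nonempty set of alternatives with costs $c_j>0$ and a budget $B\ge\max_j c_j$; a set $W\subseteq\mathcal A$ is *feasible* if $c(W)=\sum_{j\in W}c_j\le B$. In the *unit-cost setting* $c_j=1$ for all $j$ and $B$ is an integer. Each alternative $j$ has a quality $L_j\in\mathcal L=\{0,1,\dots,\bar\ell\}$ (with a prior distribution on $\mathcal L$), and the utility of $W$ under the quality vector $L=(L_j)_{j\in\mathcal A}$ is $v_L(W)=\sum_{j\in W}L_j$ or $v_L(W)=\sum_{j\in W}c_jL_j$ (these coincide for unit costs). An information structure consists of numbers $Q_j^\ell\in(0,1)$ ($j\in\mathcal A$, $\ell\in\mathcal L$); it is *quality dominant* if $Q_j^{\ell}>Q_{j'}^{\ell'}$ for all (not necessarily distinct) $j,j'\in\mathcal A$ and all $\ell>\ell'$ in $\mathcal L$. Given $L$, each of $n$ agents $i$ receives for each $j$ a binary signal that is positive with probability $Q_j^{L_j}$, all signals being independent. Under *informative voting* agent $i$ approves exactly the alternatives about which $i$ has a positive signal; call the resulting ballot profile $S$. A voting rule $r$ maps the profile, the costs and the budget to a set $r(S)$ of winners. Its *performance*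 with $n$ agents is $$\mathcal P(r,n)=\min_{L\in\mathcal L^{\mathcal A}}\frac{\mathbb E_{S}\,[v_L(r(S))\mid L]}{\max_{W\text{ feasible}}v_L(W)},$$ the ratio being read as $1$ when the denominator is $0$. **Rules** (each with a fixed but arbitrary deterministic tie-breaking rule, i.e. a function choosing one element of every nonempty set of tied options). * *AV*: go through the alternatives in decreasing order of their number of approvals, adding each one that fits in the remaining budget. * *Greedy Cover*: repeatedly add, among the alternatives that fit in the remaining budget, one approved by the largest number of agents who approve no alternative selected so far, until nothing fits. * *Phragmén*: start with $W=\emptyset$ and loads $O_i=0$. Repeatedly, among the unselected alternatives that fit in the remaining budget, add one that minimizes the number $x$ with $\sum_{i\text{ approves }j}\max(0,x-O_i)=c_j$ ($x=\infty$ if nobody approves $j$), and set $O_i\leftarrow\max(O_i,x)$ for its approvers, until nothing fits. * *MES*: every agent starts with $b_i=B/n$. Repeatedly, among the unselected alternatives $j$ with $\sum_{i\text{ approves }j}b_i\ge c_j$, add one that minimizes the least $p_j$ with $\sum_{i\text{ approves }j}\min(b_i,p_j)\ge c_j$, and set $b_i\leftarrow b_i-\min(b_i,p_j)$ for its approvers,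 until there is no such alternative. *MES+$r$*: after MES, apply $r$ to the same ballots, the unselected alternatives and the unspent budget, and add its winners. * *PAV*: output a feasible $W$ maximizing $\sum_i\bigl(1+\tfrac12+\dots+\tfrac1{k_i(W)}\bigr)$, where $k_i(W)$ is the number of members of $W$ that agent $i$ approves. **Theorem.** In the unit-cost setting, for every quality-dominant information structure, and under informative voting, every rule $r\in\{\text{AV},\ \text{Greedy Cover},\ \text{Phragmén},\ \text{MES+AV},\ \text{MES+Phragmén},\ \text{PAV}\}$ satisfies $$\lim_{n\to\infty}\mathcal P(r,n)=1.$$ Moreover, for every quality vector $L$, the probability (given $L$) that $r(S)$ is a feasible set of maximum utility $v_L$ tends to $1$ as $n\to\infty$. -/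

import Mathlib

open Filter Topology MeasureTheory

noncomputable section

namespace EpistemicPB

/-! ### Ballots, costs and tie-breaking -/

/-- An approval profile of `n` agents: `S i j = true` iff agent `i` approves alternative `j`. -/
abbrev Profile (n : ℕ) (A : Type*) := Fin n → A → Bool

/-- A voting rule maps a ballot profile, the costs, the set `pool` of available alternatives and
the budget to a set of winners. (The pool is the set of all alternatives, except when a rule is
used to spend the budget left over by another rule on the alternatives not selected so far.) -/
abbrev VotingRule (A : Type*) :=
  (n : ℕ) → Profile n A → (c : A → ℝ) → (pool : Finset A) → (B : ℝ) → Finset A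

/-- A fixed deterministic tie-breaking rule: it picks one element of every nonempty finite set of
tied options. (Picking the first element in a predefined ordering is a special case.) -/
structure TieBreaking (α : Type*) where
  choose : Finset α → α
  choose_mem : ∀ s : Finset α, s.Nonempty → choose s ∈ s

/-- The agents that approve `j`. -/
def approvers {A : Type*} {n : ℕ} (S : Profile n A) (j : A) : Finset (Fin n) :=
  Finset.univ.filter fun i => S i j = true

/-- The (additive) cost of a set of alternatives. -/
def totalCost {A : Type*} (c : A → ℝ) (W : Finset A) : ℝ := ∑ j ∈ W, c j

open Classical in
/-- The elements of `s` at which `f` is largest. -/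
def maximizers {α β : Type*} [LinearOrder β] (s : Finset α) (f : α → β) : Finset α :=
  s.filter fun j => ∀ k ∈ s, f k ≤ f j

open Classical in
/-- The elements of `s` at which `f` is smallest. -/
def minimizers {α β : Type*} [LinearOrder β] (s : Finset α) (f : α → β) : Finset α :=
  s.filter fun j => ∀ k ∈ s, f j ≤ f k

section Rules

variable {A : Type*} [DecidableEq A]

open Classical in
/-- The available, not yet selected alternatives that still fit in the budget. -/
def affordable (c : A → ℝ) (pool : Finset A) (B : ℝ) (W : Finset A) : Finset A :=
  (pool \ W).filter fun j => totalCost c (insert j W) ≤ B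

open Classical in
/-- One greedy step: among the alternatives that still fit in the budget, add one of largest
score (the score may depend on the current selection); do nothing if none fits. -/
def greedyStep (τ : TieBreaking A) (score : Finset A → A → ℕ)
    (c : A → ℝ) (pool : Finset A) (B : ℝ) (W : Finset A) : Finset A :=
  if (affordable c pool B W).Nonempty then
    insert (τ.choose (maximizers (affordable c pool B W) (score W))) W
  else W

/-- (Greedy) Approval Voting: go through the alternatives by decreasing number of approvals, adding
each one that fits in the remaining budget. An alternative that does not fit at some moment never
fits later, so this means adding at each step a most approved alternative among those that fit.
Every effective step adds an alternative, so `pool.card` steps exhaust the process. -/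
def av (τ : TieBreaking A) : VotingRule A := fun _ S c pool B =>
  (greedyStep τ (fun _ j => (approvers S j).card) c pool B)^[pool.card] ∅

/-- The number of approvers of `j` that approve no member of `W` (the unsatisfied agents). -/
def unsatisfiedApprovals {n : ℕ} (S : Profile n A) (W : Finset A) (j : A) : ℕ :=
  ((approvers S j).filter fun i => ∀ k ∈ W, S i k = false).card

/-- Greedy Cover: at each step add the alternative, among those that fit in the remaining budget,
approved by the largest number of currently unsatisfied agents. -/
def greedyCover (τ : TieBreaking A) : VotingRule A := fun _ S c pool B =>
  (greedyStep τ (unsatisfiedApprovals S) c pool B)^[pool.card] ∅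

/-- Phragmén: given the loads `O`, the value `x` with `∑ max 0 (x - O i) = c j`, the sum being over
the approvers `i` of `j` (for `c j > 0`, it is unique if `j` has an approver). -/
def phragmenLoad {n : ℕ} (S : Profile n A) (c : A → ℝ) (O : Fin n → ℝ) (j : A) : ℝ :=
  sInf {x : ℝ | ∑ i ∈ approvers S j, max 0 (x - O i) = c j}

open Classical in
/-- The value that Phragmén minimizes: it is infinite for an alternative without approvers, for
which no `x` as above exists. -/
def phragmenKey {n : ℕ} (S : Profile n A) (c : A → ℝ) (O : Fin n → ℝ) (j : A) : WithTop ℝ :=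
  if (approvers S j).Nonempty then (phragmenLoad S c O j : WithTop ℝ) else ⊤

open Classical in
/-- One round of sequential Phragmén; the state is the current selection and the loads. -/
def phragmenStep {n : ℕ} (τ : TieBreaking A) (S : Profile n A)
    (c : A → ℝ) (pool : Finset A) (B : ℝ) (s : Finset A × (Fin n → ℝ)) :
    Finset A × (Fin n → ℝ) :=
  if (affordable c pool B s.1).Nonempty then
    let j := τ.choose (minimizers (affordable c pool B s.1) (phragmenKey S c s.2))
    (insert j s.1,
      fun i => if S i j = true then max (s.2 i) (phragmenLoad S c s.2 j) else s.2 i)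
  else s

/-- (Sequential) Phragmén, starting from zero loads. -/
def phragmen (τ : TieBreaking A) : VotingRule A := fun _ S c pool B =>
  ((phragmenStep τ S c pool B)^[pool.card] (∅, fun _ => 0)).1

open Classical in
/-- MES: the unselected alternatives whose approvers can jointly pay the cost from their remaining
shares `b`. -/
def fundable {n : ℕ} (S : Profile n A) (c : A → ℝ) (pool : Finset A)
    (W : Finset A) (b : Fin n → ℝ) : Finset A :=
  (pool \ W).filter fun j => c j ≤ ∑ i ∈ approvers S j, b i

/-- MES: the least `p` such that the approvers of `j` cover its cost when each of them pays `p`, or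
the whole remaining share if that is less than `p`. -/
def mesPrice {n : ℕ} (S : Profile n A) (c : A → ℝ) (b : Fin n → ℝ) (j : A) : ℝ :=
  sInf {p : ℝ | 0 ≤ p ∧ c j ≤ ∑ i ∈ approvers S j, min (b i) p}

open Classical in
/-- One round of MES; the state is the current selection and the remaining shares. -/
def mesStep {n : ℕ} (τ : TieBreaking A) (S : Profile n A)
    (c : A → ℝ) (pool : Finset A) (s : Finset A × (Fin n → ℝ)) : Finset A × (Fin n → ℝ) :=
  if (fundable S c pool s.1 s.2).Nonempty then
    let j := τ.choose (minimizers (fundable S c pool s.1 s.2) (mesPrice S c s.2))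
    (insert j s.1,
      fun i => if S i j = true then s.2 i - min (s.2 i) (mesPrice S c s.2 j) else s.2 i)
  else s

/-- The Method of Equal Shares, each agent starting with the share `B / n`. -/
def mes (τ : TieBreaking A) : VotingRule A := fun n S c pool B =>
  ((mesStep τ S c pool)^[pool.card] (∅, fun _ => B / n)).1

/-- MES+r: run MES, then apply `r` (to the same ballots) to spend the leftover budget on the
remaining alternatives. -/
def mesThen (τ : TieBreaking A) (r : VotingRule A) : VotingRule A := fun n S c pool B =>
  mes τ n S c pool B ∪
    r n S c (pool \ mes τ n S c pool B) (B - totalCost c (mes τ n S c pool B))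

/-- The PAV score of `W`: an agent that approves `k` members of `W` contributes
`1 + 1/2 + ⋯ + 1/k`. -/
def pavScore {n : ℕ} (S : Profile n A) (W : Finset A) : ℝ :=
  ∑ i, ∑ t ∈ Finset.Icc 1 (W.filter fun j => S i j = true).card, (1 / (t : ℝ))

open Classical in
/-- Proportional Approval Voting: a set of largest PAV score among those within budget. -/
def pav (σ : TieBreaking (Finset A)) : VotingRule A := fun _ S c pool B =>
  σ.choose (maximizers (pool.powerset.filter fun W => totalCost c W ≤ B) (pavScore S))

end Rules

/-! ### The epistemic model -/

/-- The two ground-truth utility functions: `∑ L j` and `∑ c j * L j`. -/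
inductive UtilityKind
  | normal
  | costProportional

/-- A participatory budgeting environment on the set `A` of alternatives, except for the number of
agents. The qualities range over `{0, …, maxQuality}`. -/
structure Environment (A : Type*) where
  cost : A → ℝ
  cost_pos : ∀ j, 0 < cost j
  budget : ℝ
  cost_le_budget : ∀ j, cost j ≤ budget
  maxQuality : ℕ
  /-- The prior distribution of the quality of each alternative. -/
  prior : A → PMF (Fin (maxQuality + 1))
  /-- `Q j l` is the probability of a positive signal about `j` if `j` has quality `l`. -/
  Q : A → Fin (maxQuality + 1) → ℝ
  Q_mem : ∀ j l, Q j l ∈ Set.Ioo (0 : ℝ) 1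
  utility : UtilityKind

/-- The law of a binary signal that is positive with probability `p`. -/
def signalLaw (p : ℝ) : Measure Bool :=
  ENNReal.ofReal p • Measure.dirac true + ENNReal.ofReal (1 - p) • Measure.dirac false

namespace Environment

variable {A : Type*}

/-- Vectors of qualities of the alternatives. -/
abbrev QualityVector (I : Environment A) := A → Fin (I.maxQuality + 1)

/-- The unit-cost setting (the budget is then an integer). -/
def UnitCost (I : Environment A) : Prop :=
  (∀ j, I.cost j = 1) ∧ ∃ k : ℕ, I.budget = k

/-- Quality dominance; `j` and `j'` need not be distinct. -/
def QualityDominant (I : Environment A) : Prop :=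
  ∀ j j' : A, ∀ l l' : Fin (I.maxQuality + 1), l' < l → I.Q j' l' < I.Q j l

/-- The utility of the set `W` under the quality vector `L`. -/
def value (I : Environment A) (L : I.QualityVector) (W : Finset A) : ℝ :=
  match I.utility with
  | .normal => ∑ j ∈ W, ((L j : ℕ) : ℝ)
  | .costProportional => ∑ j ∈ W, I.cost j * ((L j : ℕ) : ℝ)

variable [Fintype A]

open Classical in
/-- The winning sets within budget. -/
def feasible (I : Environment A) : Finset (Finset A) :=
  Finset.univ.filter fun W => totalCost I.cost W ≤ I.budget

theorem feasible_nonempty [Nonempty A] (I : Environment A) : I.feasible.Nonempty := by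
  refine ⟨∅, ?_⟩
  obtain ⟨j⟩ := ‹Nonempty A›
  have h : 0 ≤ I.budget := ((I.cost_pos j).trans_le (I.cost_le_budget j)).le
  exact Finset.mem_filter.mpr ⟨Finset.mem_univ _, by simpa [totalCost] using h⟩

/-- The feasible sets of maximum utility. -/
def optimalSets (I : Environment A) (L : I.QualityVector) : Set (Finset A) :=
  {W | W ∈ I.feasible ∧ ∀ W' ∈ I.feasible, I.value L W' ≤ I.value L W}

/-- The maximum utility of a feasible set. -/
def optimalValue [Nonempty A] (I : Environment A) (L : I.QualityVector) : ℝ :=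
  I.feasible.sup' I.feasible_nonempty (I.value L)

/-- The law of the ballots of `n` agents that vote informatively, i.e. report their signals,
conditioned on the quality vector `L`: all signals are independent, and a signal about `j` is
positive with probability `Q j (L j)`. -/
def profileLaw (I : Environment A) (L : I.QualityVector) (n : ℕ) : Measure (Profile n A) :=
  Measure.pi fun _ => Measure.pi fun j => signalLaw (I.Q j (L j))

/-- The winning set chosen by the rule `r`. -/
def outcome (I : Environment A) (r : VotingRule A) {n : ℕ} (S : Profile n A) : Finset A :=
  r n S I.cost Finset.univ I.budget

open Classical in
/-- The ratio of the expected utility of the outcome of `r` to the maximum utility; it is `1` if the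
maximum utility is `0` (then every set of winners is optimal). -/
def ratio [Nonempty A] (I : Environment A) (r : VotingRule A) (n : ℕ)
    (L : I.QualityVector) : ℝ :=
  if I.optimalValue L = 0 then 1
  else (∫ S, I.value L (I.outcome r S) ∂I.profileLaw L n) / I.optimalValue L

open Classical in
/-- The performance of `r` with `n` agents: the worst ratio over all quality vectors. -/
def performance [Nonempty A] (I : Environment A) (r : VotingRule A) (n : ℕ) : ℝ :=
  (Finset.univ : Finset I.QualityVector).inf' Finset.univ_nonempty (I.ratio r n)

end Environment

end EpistemicPB

end

/-! Fix the quality vector `L` and put `q j = Q j (L j)`. By quality dominance a higher quality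
forces a higher `q`, so any `k` alternatives with the largest `q` form an optimal set
(`mem_optimalSets_of_isTop`). It remains to see that each rule selects such a set with probability
tending to one.

The signals of one agent are independent. Hence, for a set `W` and an opinion pattern `U` on `W`,
the probability that a ballot agrees with `U` on `W` and approves `j ∉ W` is `w * q j`, with `w > 0`
not depending on `j`. By the law of large numbers the corresponding counts are eventually ordered
strictly like `q`. There are finitely many such comparisons, independently of `n`, so with
probability tending to one all hold at once: the profile is representative
(`tendsto_not_isRepresentative`).

On a representative profile the rules are analysed without probability. When `W` has been selected,
an agent's satisfaction, load, remaining share or marginal PAV weight depends only on its ballot on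
`W`. A sum of such weights over the approvers of `j ∉ W` is therefore a nonnegative combination of
the counts above, and is strictly larger for larger `q` (`IsRepresentative.sum_lt_sum`). So each
sequential rule always adds a `q`-maximal remaining alternative, and an exchange argument handles
PAV. Tie-breaking matters only among alternatives with equal `q`, where any choice is harmless. -/

namespace EpistemicPB

/-! ### Behaviour of the rules on representative profiles. -/

section Deterministic

variable {A : Type*}

/-! ### Sets of top alternatives -/

/-- `W` is a subset of `P` that is upward closed in `P` with respect to `q`. -/
def IsUpperIn (q : A → ℝ) (P W : Finset A) : Prop :=
  W ⊆ P ∧ ∀ j ∈ W, ∀ k ∈ P, q j < q k → k ∈ W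

/-- `W` consists of `k` alternatives of `P` with the largest values of `q` (of all alternatives if
there are fewer than `k`). -/
def IsTop (q : A → ℝ) (P : Finset A) (k : ℕ) (W : Finset A) : Prop :=
  IsUpperIn q P W ∧ W.card = min P.card k

theorem isUpperIn_empty (q : A → ℝ) (P : Finset A) : IsUpperIn q P ∅ :=
  ⟨Finset.empty_subset _, by simp⟩

theorem totalCost_of_unit {c : A → ℝ} (hc : ∀ j, c j = 1) (W : Finset A) :
    totalCost c W = W.card := by
  simp [totalCost, hc]

theorem mem_maximizers {α β : Type*} [LinearOrder β] {s : Finset α} {f : α → β} {a : α} :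
    a ∈ maximizers s f ↔ a ∈ s ∧ ∀ b ∈ s, f b ≤ f a := by
  simp [maximizers]

theorem mem_minimizers {α β : Type*} [LinearOrder β] {s : Finset α} {f : α → β} {a : α} :
    a ∈ minimizers s f ↔ a ∈ s ∧ ∀ b ∈ s, f a ≤ f b := by
  simp [minimizers]

theorem TieBreaking.choose_maximizers {α β : Type*} [LinearOrder β] (τ : TieBreaking α)
    {s : Finset α} (hs : s.Nonempty) (f : α → β) :
    τ.choose (maximizers s f) ∈ s ∧ ∀ b ∈ s, f b ≤ f (τ.choose (maximizers s f)) := by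
  obtain ⟨a, ha, h⟩ := s.exists_max_image f hs
  exact mem_maximizers.1 (τ.choose_mem _ ⟨a, mem_maximizers.2 ⟨ha, h⟩⟩)

theorem TieBreaking.choose_minimizers {α β : Type*} [LinearOrder β] (τ : TieBreaking α)
    {s : Finset α} (hs : s.Nonempty) (f : α → β) :
    τ.choose (minimizers s f) ∈ s ∧ ∀ b ∈ s, f (τ.choose (minimizers s f)) ≤ f b := by
  obtain ⟨a, ha, h⟩ := s.exists_min_image f hs
  exact mem_minimizers.1 (τ.choose_mem _ ⟨a, mem_minimizers.2 ⟨ha, h⟩⟩)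

/-! ### Loads and prices -/

variable {n : ℕ}

/-- Intermediate value theorem: the sum is continuous in `x` and vanishes below all loads. The bound
`x ≤ y` is what later compares two Phragmén loads. -/
theorem exists_sum_max_eq {S : Profile n A} {O : Fin n → ℝ} {j : A} {v y : ℝ} (hv : 0 ≤ v)
    (hy : v ≤ ∑ i ∈ approvers S j, max 0 (y - O i)) :
    ∃ x ≤ y, ∑ i ∈ approvers S j, max 0 (x - O i) = v := by
  obtain ⟨m, hm⟩ := (Set.finite_range O).bddBelow
  have hm' : ∀ i, m ≤ O i := fun i => hm ⟨i, rfl⟩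
  have hcont : Continuous fun x : ℝ => ∑ i ∈ approvers S j, max 0 (x - O i) := by fun_prop
  have h0 : ∑ i ∈ approvers S j, max 0 (min m y - O i) = 0 :=
    Finset.sum_eq_zero fun i _ => max_eq_left (by linarith [min_le_left m y, hm' i])
  obtain ⟨x, hx, hxv⟩ := intermediate_value_Icc (min_le_right m y) hcont.continuousOn
    (show v ∈ Set.Icc _ _ from ⟨h0.le.trans hv, hy⟩)
  exact ⟨x, hx.2, hxv⟩

/-- Below all loads the sum is `0 ≠ v`. Without this bound the real `sInf` could take its default
value `0`. -/
theorem bddBelow_phragmen (S : Profile n A) (O : Fin n → ℝ) (j : A) {v : ℝ} (hv : 0 < v) :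
    BddBelow {x : ℝ | ∑ i ∈ approvers S j, max 0 (x - O i) = v} := by
  obtain ⟨m, hm⟩ := (Set.finite_range O).bddBelow
  refine ⟨m, fun x hx => ?_⟩
  by_contra! hlt
  have h0 : ∑ i ∈ approvers S j, max 0 (x - O i) = 0 :=
    Finset.sum_eq_zero fun i _ => max_eq_left (by linarith [hm ⟨i, rfl⟩])
  exact hv.ne (h0.symm.trans hx)

theorem sum_phragmenLoad {S : Profile n A} {c : A → ℝ} {j : A} (hc : 0 < c j)
    (hj : (approvers S j).Nonempty) (O : Fin n → ℝ) :
    ∑ i ∈ approvers S j, max 0 (phragmenLoad S c O j - O i) = c j := by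
  obtain ⟨i₀, hi₀⟩ := hj
  have hcont : Continuous fun x : ℝ => ∑ i ∈ approvers S j, max 0 (x - O i) := by fun_prop
  -- At `x = O i₀ + c j` the approver `i₀` alone already contributes `c j`.
  have hy : c j ≤ ∑ i ∈ approvers S j, max 0 ((O i₀ + c j) - O i) := by
    refine le_trans ?_ (Finset.single_le_sum
      (f := fun i => max 0 ((O i₀ + c j) - O i)) (fun i _ => le_max_left _ _) hi₀)
    simp
  obtain ⟨x, -, hx⟩ := exists_sum_max_eq hc.le hy
  exact (isClosed_eq hcont continuous_const).csInf_mem ⟨x, hx⟩ (bddBelow_phragmen S O j hc)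

/-- The infimum is attained: the admissible prices form a closed set bounded below by `0`, and it is
nonempty because at a price above every share all approvers pay everything they have. -/
theorem mesPrice_spec {S : Profile n A} {c : A → ℝ} {b : Fin n → ℝ} {j : A}
    (hj : c j ≤ ∑ i ∈ approvers S j, b i) :
    0 ≤ mesPrice S c b j ∧ c j ≤ ∑ i ∈ approvers S j, min (b i) (mesPrice S c b j) := by
  obtain ⟨m, hm⟩ := (Set.finite_range b).bddAbove
  have hcont : Continuous fun p : ℝ => ∑ i ∈ approvers S j, min (b i) p := by fun_prop
  have hcl : IsClosed {p : ℝ | 0 ≤ p ∧ c j ≤ ∑ i ∈ approvers S j, min (b i) p} :=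
    (isClosed_le continuous_const continuous_id).inter (isClosed_le continuous_const hcont)
  refine hcl.csInf_mem ⟨max 0 m, le_max_left _ _, hj.trans (le_of_eq ?_)⟩ ⟨0, fun p hp => hp.1⟩
  exact Finset.sum_congr rfl fun i _ => (min_eq_left ((hm ⟨i, rfl⟩).trans (le_max_right _ _))).symm

/-! ### Greedy processes -/

variable [DecidableEq A]

theorem IsUpperIn.insert {q : A → ℝ} {P W : Finset A} (h : IsUpperIn q P W) {j : A}
    (hj : j ∈ P) (hmax : ∀ k ∈ P \ W, q k ≤ q j) : IsUpperIn q P (insert j W) := by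
  refine ⟨Finset.insert_subset hj h.1, fun a ha k hk hlt => ?_⟩
  by_contra hk'
  rw [Finset.mem_insert, not_or] at hk'
  rcases Finset.mem_insert.1 ha with rfl | ha
  · exact absurd hlt (not_lt.2 (hmax k (Finset.mem_sdiff.2 ⟨hk, hk'.2⟩)))
  · exact hk'.2 (h.2 a ha k hk hlt)

/-- Filling up an upward closed set with top alternatives of the rest gives a top set. -/
theorem IsUpperIn.union_isTop {q : A → ℝ} {P V W : Finset A} {k : ℕ} (hV : IsUpperIn q P V)
    (hk : V.card ≤ k) (hW : IsTop q (P \ V) (k - V.card) W) : IsTop q P k (V ∪ W) := by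
  have hWV := hW.1.1
  refine ⟨⟨Finset.union_subset hV.1 (hWV.trans Finset.sdiff_subset), fun j hj a ha hlt => ?_⟩, ?_⟩
  · by_cases haV : a ∈ V
    · exact Finset.mem_union_left _ haV
    rcases Finset.mem_union.1 hj with hj | hj
    · exact Finset.mem_union_left _ (hV.2 j hj a ha hlt)
    · exact Finset.mem_union_right _ (hW.1.2 j hj a (Finset.mem_sdiff.2 ⟨ha, haV⟩) hlt)
  · have hd : Disjoint V W := Finset.disjoint_right.2 fun a ha => (Finset.mem_sdiff.1 (hWV ha)).2
    have h1 := Finset.card_sdiff_add_card_eq_card hV.1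
    rw [Finset.card_union_of_disjoint hd, hW.2]
    omega

theorem mem_affordable {c : A → ℝ} (hc : ∀ j, c j = 1) {P W : Finset A} {k : ℕ} {j : A} :
    j ∈ affordable c P k W ↔ j ∈ P \ W ∧ W.card < k := by
  unfold affordable
  rw [Finset.mem_filter]
  refine and_congr_right fun hj => ?_
  rw [totalCost_of_unit hc, Finset.card_insert_of_notMem (Finset.mem_sdiff.1 hj).2]
  exact_mod_cast Nat.succ_le_iff

/-- A process that adds a `q`-maximal alternative at each step, as long as there are alternatives
left and fewer than `k` are selected, selects top alternatives. -/
theorem isTop_iterate {α : Type*} {q : A → ℝ} {P : Finset A} {k : ℕ} (f : α → α)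
    (sel : α → Finset A) (inv : α → Prop)
    (hadd : ∀ s, inv s → (P \ sel s).Nonempty → (sel s).card < k → inv (f s) ∧
      ∃ j ∈ P \ sel s, (∀ a ∈ P \ sel s, q a ≤ q j) ∧ sel (f s) = insert j (sel s))
    (hfix : ∀ s, ¬((P \ sel s).Nonempty ∧ (sel s).card < k) → f s = s)
    {s : α} (hs : inv s) (hsel : sel s = ∅) : IsTop q P k (sel (f^[P.card] s)) := by
  -- The count `min t (min P.card k)` covers both the effective steps and the idle ones after the
  -- process has stopped.
  have key : ∀ t : ℕ, inv (f^[t] s) ∧ IsUpperIn q P (sel (f^[t] s)) ∧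
      (sel (f^[t] s)).card = min t (min P.card k) := by
    intro t
    induction t with
    | zero => simpa [hs, hsel] using isUpperIn_empty q P
    | succ t ih =>
      rw [Function.iterate_succ_apply']
      generalize f^[t] s = u at ih ⊢
      obtain ⟨hinv, hup, hcard⟩ := ih
      have hsd := Finset.card_sdiff_add_card_eq_card hup.1
      by_cases h : (P \ sel u).Nonempty ∧ (sel u).card < k
      · obtain ⟨hinv', j, hj, hmax, heq⟩ := hadd u hinv h.1 h.2
        obtain ⟨hjP, hjW⟩ := Finset.mem_sdiff.1 hj
        refine ⟨hinv', heq ▸ hup.insert hjP hmax, ?_⟩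
        have := h.1.card_pos
        rw [heq, Finset.card_insert_of_notMem hjW]
        omega
      · rw [hfix u h]
        refine ⟨hinv, hup, ?_⟩
        rw [← Finset.card_pos] at h
        omega
  obtain ⟨-, h, h'⟩ := key P.card
  exact ⟨h, by rw [h']; omega⟩

/-! ### Representative profiles -/

/-- The approvers of `j` whose ballot agrees with `U` on `W`. -/
def matchingApprovers (S : Profile n A) (W : Finset A) (U : A → Bool) (j : A) : Finset (Fin n) :=
  (approvers S j).filter fun i => ∀ k ∈ W, S i k = U k

/-- A profile is representative for `q` if every alternative is approved, and, among the agents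
with any given opinion on a set `W` of alternatives, alternatives outside `W` with larger `q` have
more approvers. -/
structure IsRepresentative (S : Profile n A) (q : A → ℝ) : Prop where
  approvers_nonempty : ∀ j, (approvers S j).Nonempty
  card_lt : ∀ (W : Finset A) (U : A → Bool) (j k : A), j ∉ W → k ∉ W → q j < q k →
    (matchingApprovers S W U j).card < (matchingApprovers S W U k).card

/-- The function `h` on the agents depends only on their opinions on `W`. -/
def DependsOnBallotsOn (S : Profile n A) (W : Finset A) (h : Fin n → ℝ) : Prop :=
  ∀ i i', (∀ k ∈ W, S i k = S i' k) → h i = h i'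

/-- Group the agents by the restriction of their ballot to `W`; `h` is constant on each group, with
value `g U`. -/
theorem sum_approvers_eq_sum_matchingApprovers {S : Profile n A} {W : Finset A} {h : Fin n → ℝ}
    (hW : DependsOnBallotsOn S W h) :
    ∃ (T : Finset (A → Bool)) (g : (A → Bool) → ℝ),
      (∀ i, ∃ U ∈ T, g U = h i) ∧ (∀ U ∈ T, ∃ i, g U = h i) ∧
      ∀ j, ∑ i ∈ approvers S j, h i = ∑ U ∈ T, (matchingApprovers S W U j).card * g U := by
  classical
  -- Setting the ballot to `false` outside `W` makes `R i = R i'` equivalent to agreement on `W`.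
  let R : Fin n → A → Bool := fun i k => if k ∈ W then S i k else false
  have hR : ∀ i i', R i = R i' ↔ ∀ k ∈ W, S i k = S i' k := by
    intro i i'
    refine ⟨fun h k hk => by simpa [R, hk] using congrFun h k, fun h => funext fun k => ?_⟩
    by_cases hk : k ∈ W <;> simp [R, hk, h]
  let g : (A → Bool) → ℝ := fun U => if hU : ∃ i, R i = U then h hU.choose else 0
  have hg : ∀ i, g (R i) = h i := by
    intro i
    have hU : ∃ i', R i' = R i := ⟨i, rfl⟩
    simp only [g, dif_pos hU]
    exact hW _ _ ((hR _ _).1 hU.choose_spec)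
  refine ⟨Finset.univ.image R, g, fun i => ⟨R i, by simp, hg i⟩, fun U hU => ?_, fun j => ?_⟩
  · obtain ⟨i, -, rfl⟩ := Finset.mem_image.1 hU
    exact ⟨i, hg i⟩
  · rw [← Finset.sum_fiberwise_of_maps_to (t := Finset.univ.image R) (g := R) (by simp)]
    refine Finset.sum_congr rfl fun U hU => ?_
    obtain ⟨i₀, -, rfl⟩ := Finset.mem_image.1 hU
    have : (approvers S j).filter (fun i => R i = R i₀) = matchingApprovers S W (R i₀) j := by
      refine Finset.filter_congr fun i _ => ?_
      rw [hR]
      exact forall₂_congr fun k hk => by simp [R, hk]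
    rw [this, ← nsmul_eq_mul, hg, ← Finset.sum_const]
    refine Finset.sum_congr rfl fun i hi => ?_
    rw [← this, Finset.mem_filter] at hi
    rw [← hg i, hi.2, hg]

/-- The common engine for Phragmén, MES and PAV: after grouping by patterns on `W`, each count for
`k` exceeds that for `j`, and some pattern carries positive weight, so the inequality is strict. -/
theorem IsRepresentative.sum_lt_sum {S : Profile n A} {q : A → ℝ} (hS : IsRepresentative S q)
    {W : Finset A} {h : Fin n → ℝ} (hW : DependsOnBallotsOn S W h) (h0 : ∀ i, 0 ≤ h i)
    (hpos : ∃ i, 0 < h i) {j k : A} (hj : j ∉ W) (hk : k ∉ W) (hjk : q j < q k) :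
    ∑ i ∈ approvers S j, h i < ∑ i ∈ approvers S k, h i := by
  obtain ⟨T, g, hg1, hg2, hsum⟩ := sum_approvers_eq_sum_matchingApprovers hW
  rw [hsum, hsum]
  obtain ⟨i, hi⟩ := hpos
  obtain ⟨U, hU, hgU⟩ := hg1 i
  refine Finset.sum_lt_sum (fun V hV => ?_) ⟨U, hU, ?_⟩
  · obtain ⟨i', hi'⟩ := hg2 V hV
    exact mul_le_mul_of_nonneg_right (by exact_mod_cast (hS.card_lt W V j k hj hk hjk).le)
      (hi' ▸ h0 i')
  · exact mul_lt_mul_of_pos_right (by exact_mod_cast hS.card_lt W U j k hj hk hjk) (hgU ▸ hi)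

/-! ### AV and Greedy Cover -/

theorem isTop_greedy (τ : TieBreaking A) {q : A → ℝ} {c : A → ℝ} (hc : ∀ j, c j = 1)
    (P : Finset A) (k : ℕ) (score : Finset A → A → ℕ)
    (hscore : ∀ W j a, j ∉ W → a ∉ W → q j < q a → score W j < score W a) :
    IsTop q P k ((greedyStep τ score c P k)^[P.card] ∅) := by
  refine isTop_iterate (greedyStep τ score c P k) id (fun _ => True) (fun W _ hne hk => ?_)
    (fun W hW => if_neg ?_) trivial rfl
  · have hne' : (affordable c P k W).Nonempty := hne.imp fun j hj => (mem_affordable hc).2 ⟨hj, hk⟩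
    obtain ⟨h1, h2⟩ := τ.choose_maximizers hne' (score W)
    refine ⟨trivial, _, ((mem_affordable hc).1 h1).1, fun a ha => ?_, if_pos hne'⟩
    by_contra! hlt
    exact absurd (hscore W _ a (Finset.mem_sdiff.1 ((mem_affordable hc).1 h1).1).2
      (Finset.mem_sdiff.1 ha).2 hlt) (not_lt.2 (h2 a ((mem_affordable hc).2 ⟨ha, hk⟩)))
  · exact fun ⟨j, hj⟩ => hW ⟨⟨j, ((mem_affordable hc).1 hj).1⟩, ((mem_affordable hc).1 hj).2⟩

theorem isTop_av (τ : TieBreaking A) {S : Profile n A} {q : A → ℝ} (hS : IsRepresentative S q)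
    {c : A → ℝ} (hc : ∀ j, c j = 1) (P : Finset A) (k : ℕ) : IsTop q P k (av τ n S c P k) := by
  refine isTop_greedy τ hc P k _ fun _ j a _ _ h => ?_
  -- Plain approval counts are the case `W = ∅`.
  simpa [matchingApprovers] using
    hS.card_lt ∅ (fun _ => false) j a (Finset.notMem_empty _) (Finset.notMem_empty _) h

/-- The unsatisfied approvers are the matching approvers for the all-`false` pattern on the current
selection. -/
theorem isTop_greedyCover (τ : TieBreaking A) {S : Profile n A} {q : A → ℝ}
    (hS : IsRepresentative S q) {c : A → ℝ} (hc : ∀ j, c j = 1) (P : Finset A) (k : ℕ) :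
    IsTop q P k (greedyCover τ n S c P k) :=
  isTop_greedy τ hc P k _ fun W j a hj ha h => hS.card_lt W (fun _ => false) j a hj ha h

/-! ### Phragmén -/

/-- At the load `y` of `j`, the weights `max 0 (y - O i)` sum to `1` over the approvers of `j`,
hence to more than `1` over those of `k`. So `k` reaches its cost strictly before `y`. -/
theorem IsRepresentative.phragmenLoad_lt {S : Profile n A} {q : A → ℝ} (hS : IsRepresentative S q)
    {c : A → ℝ} (hc : ∀ j, c j = 1) {W : Finset A} {O : Fin n → ℝ}
    (hO : DependsOnBallotsOn S W O) {j k : A} (hj : j ∉ W) (hk : k ∉ W) (hjk : q j < q k) :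
    phragmenLoad S c O k < phragmenLoad S c O j := by
  have hc0 : ∀ j, 0 < c j := fun j => by simp [hc]
  have h1 := sum_phragmenLoad (hc0 j) (hS.approvers_nonempty j) O
  set y := phragmenLoad S c O j with hy
  have hpos : ∃ i, 0 < max 0 (y - O i) := by
    by_contra! h
    exact (hc0 j).not_ge (h1 ▸ Finset.sum_nonpos fun i _ => h i)
  have h2 : c k < ∑ i ∈ approvers S k, max 0 (y - O i) := by
    rw [hc k, ← hc j, ← h1]
    exact hS.sum_lt_sum (h := fun i => max 0 (y - O i))
      (fun i i' h => by simp only [hO i i' h]) (fun i => le_max_left _ _) hpos hj hk hjk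
  obtain ⟨x, hx, hxe⟩ := exists_sum_max_eq (hc0 k).le h2.le
  have hne : x ≠ y := by
    rintro rfl
    exact h2.ne hxe.symm
  exact (csInf_le (bddBelow_phragmen S O k (hc0 k)) hxe).trans_lt (lt_of_le_of_ne hx hne)

/-- Preserves the invariant of Phragmén and MES: a round alters an agent's number according to its
opinion on `j`, and `j` joins the selection. -/
theorem DependsOnBallotsOn.update {S : Profile n A} {W : Finset A} {h : Fin n → ℝ}
    (hW : DependsOnBallotsOn S W h) (j : A) (F : ℝ → ℝ) :
    DependsOnBallotsOn S (insert j W) fun i => if S i j = true then F (h i) else h i := by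
  intro i i' hii
  have h1 := hW i i' fun k hk => hii k (Finset.mem_insert_of_mem hk)
  have h2 := hii j (Finset.mem_insert_self j W)
  simp only [h1, h2]

theorem isTop_phragmen (τ : TieBreaking A) {S : Profile n A} {q : A → ℝ}
    (hS : IsRepresentative S q) {c : A → ℝ} (hc : ∀ j, c j = 1) (P : Finset A) (k : ℕ) :
    IsTop q P k (phragmen τ n S c P k) := by
  refine isTop_iterate (phragmenStep τ S c P k) Prod.fst (fun s => DependsOnBallotsOn S s.1 s.2)
    (fun s hs hne hk => ?_) (fun s h => if_neg ?_) (fun _ _ _ => rfl) rfl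
  · have hne' : (affordable c P k s.1).Nonempty :=
      hne.imp fun j hj => (mem_affordable hc).2 ⟨hj, hk⟩
    obtain ⟨h1, h2⟩ := τ.choose_minimizers hne' (phragmenKey S c s.2)
    rw [phragmenStep, if_pos hne']
    generalize τ.choose (minimizers (affordable c P k s.1) (phragmenKey S c s.2)) = j at h1 h2
    have hj := ((mem_affordable hc).1 h1).1
    refine ⟨hs.update j fun x => max x (phragmenLoad S c s.2 j), j, hj, fun a ha => ?_, rfl⟩
    by_contra! hlt
    have h3 := h2 a ((mem_affordable hc).2 ⟨ha, hk⟩)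
    -- Every alternative has an approver, so the key is never `⊤`.
    rw [phragmenKey, phragmenKey, if_pos (hS.approvers_nonempty _),
      if_pos (hS.approvers_nonempty _), WithTop.coe_le_coe] at h3
    exact h3.not_gt (hS.phragmenLoad_lt hc hs (Finset.mem_sdiff.1 hj).2 (Finset.mem_sdiff.1 ha).2
      hlt)
  · exact fun ⟨j, hj⟩ => h ⟨⟨j, ((mem_affordable hc).1 hj).1⟩, ((mem_affordable hc).1 hj).2⟩

/-! ### MES -/

theorem mem_fundable {S : Profile n A} {c : A → ℝ} {P W : Finset A} {b : Fin n → ℝ} {j : A} :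
    j ∈ fundable S c P W b ↔ j ∈ P \ W ∧ c j ≤ ∑ i ∈ approvers S j, b i := by
  simp [fundable]

/-- At the price `p` of `j`, the payments `min (b i) p` for `k` total strictly more than `1`. Hence
`k` is fundable as well, and by continuity a slightly lower price suffices. -/
theorem IsRepresentative.mesPrice_lt {S : Profile n A} {q : A → ℝ} (hS : IsRepresentative S q)
    {c : A → ℝ} (hc : ∀ j, c j = 1) {W : Finset A} {b : Fin n → ℝ} (hb : ∀ i, 0 ≤ b i)
    (hW : DependsOnBallotsOn S W b) {j k : A} (hj : j ∉ W) (hk : k ∉ W) (hjk : q j < q k)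
    (hfund : c j ≤ ∑ i ∈ approvers S j, b i) :
    c k ≤ ∑ i ∈ approvers S k, b i ∧ mesPrice S c b k < mesPrice S c b j := by
  have hc0 : ∀ j, 0 < c j := fun j => by simp [hc]
  obtain ⟨hp0, hp⟩ := mesPrice_spec hfund
  set p := mesPrice S c b j with hpdef
  have hpos : ∃ i, 0 < min (b i) p := by
    by_contra! h
    exact (hc0 j).not_ge (hp.trans (Finset.sum_nonpos fun i _ => h i))
  have hlt : c k < ∑ i ∈ approvers S k, min (b i) p := by
    rw [hc k, ← hc j]
    exact hp.trans_lt (hS.sum_lt_sum (h := fun i => min (b i) p)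
      (fun i i' h => by simp only [hW i i' h]) (fun i => le_min (hb i) hp0) hpos hj hk hjk)
  refine ⟨hlt.le.trans (Finset.sum_le_sum fun i _ => min_le_left _ _), ?_⟩
  have hp_pos : 0 < p := by
    obtain ⟨i, hi⟩ := hpos
    exact hi.trans_le (min_le_right _ _)
  have hcont : Continuous fun x : ℝ => ∑ i ∈ approvers S k, min (b i) x := by fun_prop
  have hev := ((hcont.tendsto p).eventually_const_lt hlt).and (eventually_gt_nhds hp_pos)
  have hlim : ∀ᶠ x in 𝓝[<] p, x < p := self_mem_nhdsWithin
  obtain ⟨x, ⟨hx1, hx2⟩, hxp⟩ := ((hev.filter_mono nhdsWithin_le_nhds).and hlim).exists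
  have hbdd : BddBelow {p : ℝ | 0 ≤ p ∧ c k ≤ ∑ i ∈ approvers S k, min (b i) p} :=
    ⟨0, fun p hp => hp.1⟩
  exact (csInf_le hbdd ⟨hx2.le, hx1.le⟩).trans_lt hxp

/-- MES may stop early, so only an upper set of at most `k` alternatives is obtained; the completion
rule fills it up. The bound on the size comes from conservation of money: the number selected plus
the remaining shares never exceeds `k`. -/
theorem mes_isUpperIn_and_card_le (τ : TieBreaking A) {S : Profile n A} {q : A → ℝ}
    (hS : IsRepresentative S q) {c : A → ℝ} (hc : ∀ j, c j = 1) (P : Finset A) (k : ℕ) :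
    IsUpperIn q P (mes τ n S c P k) ∧ (mes τ n S c P k).card ≤ k := by
  have key : ∀ t : ℕ, ∀ s, s = (mesStep τ S c P)^[t] (∅, fun _ => (k : ℝ) / n) →
      IsUpperIn q P s.1 ∧ DependsOnBallotsOn S s.1 s.2 ∧ (∀ i, 0 ≤ s.2 i) ∧
        s.1.card + ∑ i, s.2 i ≤ k := by
    intro t
    induction t with
    | zero =>
      rintro s rfl
      refine ⟨isUpperIn_empty q P, fun _ _ _ => rfl, fun _ => by simp; positivity, ?_⟩
      -- The shares add up to `k`, except that for `n = 0` there are none and the sum is `0`.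
      rcases eq_or_ne (n : ℝ) 0 with h | h
      · simp [h]
      · simp [mul_div_cancel₀ _ h]
    | succ t ih =>
      rintro s rfl
      rw [Function.iterate_succ_apply']
      obtain ⟨hup, hdep, hnn, hsum⟩ := ih _ rfl
      generalize (mesStep τ S c P)^[t] (∅, fun _ => (k : ℝ) / n) = s at *
      by_cases hne : (fundable S c P s.1 s.2).Nonempty
      swap
      · rw [mesStep, if_neg hne]
        exact ⟨hup, hdep, hnn, hsum⟩
      obtain ⟨h1, h2⟩ := τ.choose_minimizers hne (mesPrice S c s.2)
      rw [mesStep, if_pos hne]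
      generalize τ.choose (minimizers (fundable S c P s.1 s.2) (mesPrice S c s.2)) = j at h1 h2
      obtain ⟨hj, hjf⟩ := mem_fundable.1 h1
      obtain ⟨hjP, hjW⟩ := Finset.mem_sdiff.1 hj
      obtain ⟨-, hpay⟩ := mesPrice_spec hjf
      refine ⟨hup.insert hjP fun a ha => ?_,
        hdep.update j fun x => x - min x (mesPrice S c s.2 j), fun i => ?_, ?_⟩
      · by_contra! hlt
        obtain ⟨h3, h4⟩ := hS.mesPrice_lt hc hnn hdep hjW (Finset.mem_sdiff.1 ha).2 hlt hjf
        exact (h2 a (mem_fundable.2 ⟨ha, h3⟩)).not_gt h4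
      · dsimp only
        split_ifs
        · exact sub_nonneg.2 (min_le_left _ _)
        · exact hnn i
      · have hrest : ∑ i, (if S i j = true then s.2 i - min (s.2 i) (mesPrice S c s.2 j) else s.2 i)
            = ∑ i, s.2 i - ∑ i ∈ approvers S j, min (s.2 i) (mesPrice S c s.2 j) := by
          rw [approvers, Finset.sum_filter, ← Finset.sum_sub_distrib]
          exact Finset.sum_congr rfl fun i _ => by split_ifs <;> simp
        dsimp only
        rw [hrest, Finset.card_insert_of_notMem hjW]
        rw [hc] at hpay
        push_cast
        linarith
  obtain ⟨h1, -, h2, h3⟩ := key P.card _ rfl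
  refine ⟨h1, ?_⟩
  have := Finset.sum_nonneg fun i (_ : i ∈ Finset.univ) => h2 i
  exact_mod_cast (le_add_of_nonneg_right this).trans h3

/-- The hypothesis on `r` ranges over all pools and budgets because `r` is run on what MES leaves
over. -/
theorem isTop_mesThen (τ : TieBreaking A) {r : VotingRule A} {S : Profile n A} {q : A → ℝ}
    (hS : IsRepresentative S q) {c : A → ℝ} (hc : ∀ j, c j = 1)
    (hr : ∀ (P : Finset A) (k : ℕ), IsTop q P k (r n S c P k)) (P : Finset A) (k : ℕ) :
    IsTop q P k (mesThen τ r n S c P k) := by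
  obtain ⟨h1, h2⟩ := mes_isUpperIn_and_card_le τ hS hc P k
  refine h1.union_isTop h2 ?_
  rw [totalCost_of_unit hc, ← Nat.cast_sub h2]
  exact hr _ _

/-! ### PAV -/

theorem pavScore_insert (S : Profile n A) {W : Finset A} {j : A} (hj : j ∉ W) :
    pavScore S (insert j W) = pavScore S W +
      ∑ i ∈ approvers S j, 1 / (((W.filter fun k => S i k = true).card + 1 : ℕ) : ℝ) := by
  rw [pavScore, pavScore, approvers, Finset.sum_filter, ← Finset.sum_add_distrib]
  refine Finset.sum_congr rfl fun i _ => ?_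
  rw [Finset.filter_insert]
  split_ifs with h
  · rw [Finset.card_insert_of_notMem (by simp [hj]), Finset.sum_Icc_succ_top (by omega)]
  · simp

/-- Exchange argument: if `j` is selected and `a` with `q j < q a` is not, replacing `j` by `a`
raises the score, since the marginal weights over `W.erase j` depend only on the ballots on that
set. -/
theorem isTop_pav (σ : TieBreaking (Finset A)) {S : Profile n A} {q : A → ℝ}
    (hS : IsRepresentative S q) {c : A → ℝ} (hc : ∀ j, c j = 1) (P : Finset A) (k : ℕ) :
    IsTop q P k (pav σ n S c P k) := by
  have hmem : ∀ W, W ∈ P.powerset.filter (fun W => totalCost c W ≤ (k : ℝ)) ↔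
      W ⊆ P ∧ W.card ≤ k := by
    intro W
    rw [Finset.mem_filter, Finset.mem_powerset, totalCost_of_unit hc, Nat.cast_le]
  have hne : (P.powerset.filter fun W => totalCost c W ≤ (k : ℝ)).Nonempty :=
    ⟨∅, (hmem ∅).2 ⟨Finset.empty_subset _, by simp⟩⟩
  obtain ⟨h1, h2⟩ := σ.choose_maximizers hne (pavScore S)
  unfold pav
  generalize σ.choose (maximizers _ (pavScore S)) = W at h1 h2
  obtain ⟨hWP, hWk⟩ := (hmem W).1 h1
  refine ⟨⟨hWP, fun j hj a ha hlt => ?_⟩, ?_⟩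
  · by_contra haW
    have hj' : j ∉ W.erase j := Finset.notMem_erase j W
    have ha' : a ∉ W.erase j := fun h => haW (Finset.mem_of_mem_erase h)
    obtain ⟨i₀, -⟩ := hS.approvers_nonempty a
    have hgain := hS.sum_lt_sum (W := W.erase j)
      (h := fun i => 1 / ((((W.erase j).filter fun k => S i k = true).card + 1 : ℕ) : ℝ))
      (fun i i' h => by
        have : (W.erase j).filter (fun k => S i k = true) =
            (W.erase j).filter (fun k => S i' k = true) :=
          Finset.filter_congr fun k hk => by rw [h k hk]
        simp only [this])
      (fun i => by positivity) ⟨i₀, by positivity⟩ hj' ha' hlt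
    have hle := h2 (insert a (W.erase j)) ((hmem _).2
      ⟨Finset.insert_subset ha ((Finset.erase_subset _ _).trans hWP), by
        rwa [Finset.card_insert_of_notMem ha', Finset.card_erase_add_one hj]⟩)
    rw [← Finset.insert_erase hj, pavScore_insert S hj', Finset.erase_insert hj',
      pavScore_insert S ha'] at hle
    linarith
  · refine le_antisymm (le_min (Finset.card_le_card hWP) hWk) ?_
    -- Every alternative has an approver, so an addition strictly raises the score; a maximizer
    -- cannot leave both budget and alternatives unused.
    by_contra! hlt
    obtain ⟨hlt1, hlt2⟩ := lt_min_iff.1 hlt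
    obtain ⟨a, ha, haW⟩ := Finset.exists_mem_notMem_of_card_lt_card hlt1
    have hle := h2 (insert a W) ((hmem _).2 ⟨Finset.insert_subset ha hWP, by
      rw [Finset.card_insert_of_notMem haW]; omega⟩)
    rw [pavScore_insert S haW] at hle
    have : 0 < ∑ i ∈ approvers S a,
        1 / (((W.filter fun k => S i k = true).card + 1 : ℕ) : ℝ) :=
      Finset.sum_pos (fun i _ => by positivity) (hS.approvers_nonempty a)
    linarith

end Deterministic

/-! ### Profiles are representative with probability tending to one. -/

section Probability

/-! ### Concentration -/

/-- Weak law of large numbers, in the form that a sum of i.i.d. random variables of positive mean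
is positive with probability tending to one. -/
theorem tendsto_pi_sum_pos {T : Type*} [Finite T] [MeasurableSpace T] [MeasurableSingletonClass T]
    (ν : Measure T) [IsProbabilityMeasure ν] (f : T → ℝ) (hf : 0 < ∫ t, f t ∂ν) :
    Tendsto (fun n : ℕ => Measure.pi (fun _ : Fin n => ν) {S | ¬ 0 < ∑ i, f (S i)})
      atTop (𝓝 0) := by
  have hmem : MemLp f 2 ν := MemLp.of_discrete
  set μ := ∫ t, f t ∂ν with hμ
  set v := ProbabilityTheory.variance f ν with hv
  -- Chebyshev: a nonpositive sum deviates from its mean `n * μ` by at least `n * μ`, and its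
  -- variance is `n * v`.
  have hbound : ∀ n : ℕ, 0 < n → Measure.pi (fun _ : Fin n => ν) {S | ¬ 0 < ∑ i, f (S i)} ≤
      ENNReal.ofReal (v / μ ^ 2 * (n : ℝ)⁻¹) := by
    intro n hn
    have hn' : (0 : ℝ) < n := Nat.cast_pos.2 hn
    let X : (Fin n → T) → ℝ := ∑ i : Fin n, fun S => f (S i)
    have hXm : MemLp X 2 (Measure.pi fun _ : Fin n => ν) := MemLp.of_discrete
    have hmean : ∫ S, X S ∂(Measure.pi fun _ : Fin n => ν) = n * μ := by
      simp only [X, Finset.sum_apply]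
      rw [integral_finsetSum _ fun i _ => Integrable.of_finite]
      simp [integral_comp_eval (μ := fun _ : Fin n => ν) (f := f)
        Integrable.of_finite.aestronglyMeasurable, hμ]
    have hvar : ProbabilityTheory.variance X (Measure.pi fun _ : Fin n => ν) = n * v := by
      rw [ProbabilityTheory.variance_sum_pi (X := fun _ : Fin n => f) fun _ => hmem]
      simp [hv]
    have hcheb := ProbabilityTheory.meas_ge_le_variance_div_sq hXm (mul_pos hn' hf)
    rw [hmean, hvar] at hcheb
    refine (measure_mono fun S hS => ?_).trans (hcheb.trans (ENNReal.ofReal_le_ofReal (le_of_eq ?_)))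
    · have : X S ≤ 0 := by simpa [X, Finset.sum_apply] using hS
      show _ ≤ |X S - n * μ|
      rw [abs_sub_comm]
      exact le_trans (by linarith) (le_abs_self _)
    · field_simp
  have hlim : Tendsto (fun n : ℕ => ENNReal.ofReal (v / μ ^ 2 * (n : ℝ)⁻¹)) atTop (𝓝 0) := by
    have := ENNReal.tendsto_ofReal
      ((tendsto_inv_atTop_nhds_zero_nat (𝕜 := ℝ)).const_mul (v / μ ^ 2))
    simpa using this
  exact tendsto_of_tendsto_of_tendsto_of_le_of_le' tendsto_const_nhds hlim
    (Eventually.of_forall fun _ => zero_le) ((eventually_gt_atTop 0).mono hbound)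

variable {A : Type*} [Fintype A]

theorem isProbabilityMeasure_signalLaw {p : ℝ} (hp : p ∈ Set.Ioo (0 : ℝ) 1) :
    IsProbabilityMeasure (signalLaw p) := by
  constructor
  simp only [signalLaw, Measure.add_apply, Measure.smul_apply, measure_univ, smul_eq_mul, mul_one]
  rw [← ENNReal.ofReal_add hp.1.le (by linarith [hp.2])]
  simp

theorem signalLaw_real_true {p : ℝ} (hp : p ∈ Set.Ioo (0 : ℝ) 1) :
    (signalLaw p).real {true} = p := by
  simp [signalLaw, Measure.real, hp.1.le]

theorem signalLaw_real_false {p : ℝ} (hp : p ∈ Set.Ioo (0 : ℝ) 1) :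
    (signalLaw p).real {false} = 1 - p := by
  simp [signalLaw, Measure.real, hp.2.le]

theorem signalLaw_real_singleton_pos {p : ℝ} (hp : p ∈ Set.Ioo (0 : ℝ) 1) (b : Bool) :
    0 < (signalLaw p).real {b} := by
  cases b
  · rw [signalLaw_real_false hp]; linarith [hp.2]
  · rw [signalLaw_real_true hp]; exact hp.1

/-- The law of a ballot on which the signals are independent and positive with probabilities `q`. -/
noncomputable def ballotLaw (q : A → ℝ) : Measure (A → Bool) :=
  Measure.pi fun j => signalLaw (q j)

theorem isProbabilityMeasure_ballotLaw {q : A → ℝ} (hq : ∀ j, q j ∈ Set.Ioo (0 : ℝ) 1) :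
    IsProbabilityMeasure (ballotLaw q) := by
  have := fun j => isProbabilityMeasure_signalLaw (hq j)
  unfold ballotLaw
  infer_instance

/-- A ballot agrees with `U` on `W` and approves `j` with probability proportional to `q j`. -/
theorem ballotLaw_real_matching {q : A → ℝ} (hq : ∀ j, q j ∈ Set.Ioo (0 : ℝ) 1) (W : Finset A)
    (U : A → Bool) :
    ∃ w : ℝ, 0 < w ∧ ∀ j ∉ W,
      (ballotLaw q).real {s | s j = true ∧ ∀ k ∈ W, s k = U k} = w * q j := by
  classical
  have := fun j => isProbabilityMeasure_signalLaw (hq j)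
  refine ⟨∏ k ∈ W, (signalLaw (q k)).real {U k},
    Finset.prod_pos fun k _ => signalLaw_real_singleton_pos (hq k) _, fun j hj => ?_⟩
  -- The event is a box: coordinates in `W` and at `j` are prescribed, the others free. As `j ∉ W`,
  -- its measure factors with `q j` split off.
  have hset : {s : A → Bool | s j = true ∧ ∀ k ∈ W, s k = U k} = Set.univ.pi fun k =>
      if k ∈ W then {U k} else if k = j then {true} else Set.univ := by
    ext s
    simp only [Set.mem_ofPred_eq, Set.mem_pi, Set.mem_univ, true_implies]
    constructor
    · rintro ⟨h1, h2⟩ k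
      split_ifs with hk hkj
      · exact h2 k hk
      · exact hkj ▸ h1
      · trivial
    · intro h
      refine ⟨by simpa [hj] using h j, fun k hk => by simpa [hk] using h k⟩
  rw [Measure.real, hset, ballotLaw, Measure.pi_pi, ENNReal.toReal_prod]
  have hfac : ∀ k, ((signalLaw (q k)) (if k ∈ W then {U k} else if k = j then {true}
      else Set.univ)).toReal =
      (if k ∈ W then (signalLaw (q k)).real {U k} else 1) * (if k = j then q j else 1) := by
    intro k
    by_cases hk : k ∈ W
    · have : k ≠ j := by rintro rfl; exact hj hk
      simp [hk, this, Measure.real]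
    · by_cases hkj : k = j
      · subst hkj
        simpa [hk, Measure.real] using signalLaw_real_true (hq k)
      · rw [if_neg hk, if_neg hkj, measure_univ]
        simp [hk, hkj]
  simp_rw [hfac]
  rw [Finset.prod_mul_distrib]
  simp

theorem sum_indicator_eq_card_matchingApprovers {n : ℕ} (S : Profile n A) (W : Finset A)
    (U : A → Bool) (j : A) :
    ∑ i, {s : A → Bool | s j = true ∧ ∀ k ∈ W, s k = U k}.indicator (1 : (A → Bool) → ℝ) (S i) =
      (matchingApprovers S W U j).card := by
  classical
  simp only [matchingApprovers, approvers, Finset.filter_filter, Set.indicator_apply,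
    Set.mem_ofPred_eq, Pi.one_apply, Finset.sum_boole]
  congr

/-- The difference of the two counts is a sum of i.i.d. differences of indicators, each of mean `w *
q k - w * q j > 0`. -/
theorem tendsto_not_card_lt {q : A → ℝ} (hq : ∀ j, q j ∈ Set.Ioo (0 : ℝ) 1) (W : Finset A)
    (U : A → Bool) {j k : A} (hj : j ∉ W) (hk : k ∉ W) (hjk : q j < q k) :
    Tendsto (fun n : ℕ => Measure.pi (fun _ : Fin n => ballotLaw q)
      {S | ¬ (matchingApprovers S W U j).card < (matchingApprovers S W U k).card})
      atTop (𝓝 0) := by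
  have := isProbabilityMeasure_ballotLaw hq
  obtain ⟨w, hw, hmeas⟩ := ballotLaw_real_matching hq W U
  let E : A → Set (A → Bool) := fun j => {s | s j = true ∧ ∀ k ∈ W, s k = U k}
  have hint : 0 < ∫ s, ((E k).indicator (1 : (A → Bool) → ℝ) s
      - (E j).indicator (1 : (A → Bool) → ℝ) s) ∂ballotLaw q := by
    rw [integral_sub Integrable.of_finite Integrable.of_finite,
      integral_indicator_one (MeasurableSet.of_discrete),
      integral_indicator_one (MeasurableSet.of_discrete), hmeas j hj, hmeas k hk, sub_pos]
    exact mul_lt_mul_of_pos_left hjk hw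
  have h := tendsto_pi_sum_pos (ballotLaw q) _ hint
  simpa only [Finset.sum_sub_distrib, E, sum_indicator_eq_card_matchingApprovers, sub_pos,
    Nat.cast_lt] using h

theorem tendsto_not_approvers_nonempty {q : A → ℝ} (hq : ∀ j, q j ∈ Set.Ioo (0 : ℝ) 1) (j : A) :
    Tendsto (fun n : ℕ => Measure.pi (fun _ : Fin n => ballotLaw q)
      {S | ¬ (approvers S j).Nonempty}) atTop (𝓝 0) := by
  have := isProbabilityMeasure_ballotLaw hq
  obtain ⟨w, hw, hmeas⟩ := ballotLaw_real_matching hq ∅ fun _ => true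
  let E : Set (A → Bool) := {s | s j = true ∧ ∀ k ∈ (∅ : Finset A), s k = true}
  have hint : 0 < ∫ s, E.indicator (1 : (A → Bool) → ℝ) s ∂ballotLaw q := by
    rw [integral_indicator_one (MeasurableSet.of_discrete), hmeas j (Finset.notMem_empty j)]
    exact mul_pos hw (hq j).1
  have h := tendsto_pi_sum_pos (ballotLaw q) _ hint
  simp only [E] at h
  simp_rw [sum_indicator_eq_card_matchingApprovers (U := fun _ => true)] at h
  simpa [matchingApprovers, Finset.nonempty_iff_ne_empty] using h

/-- Union bound over the possible failures, whose finite index type does not depend on `n`. -/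
theorem tendsto_not_isRepresentative {q : A → ℝ} (hq : ∀ j, q j ∈ Set.Ioo (0 : ℝ) 1) :
    Tendsto (fun n : ℕ => Measure.pi (fun _ : Fin n => ballotLaw q)
      {S : Profile n A | ¬ IsRepresentative S q}) atTop (𝓝 0) := by
  classical
  let P : (n : ℕ) → A ⊕ (Finset A × (A → Bool) × A × A) → Set (Profile n A) := fun n x =>
    match x with
    | .inl j => {S | ¬ (approvers S j).Nonempty}
    -- The side conditions are part of the event, so that it is empty for irrelevant indices.
    | .inr (W, U, j, k) => {S | (j ∉ W ∧ k ∉ W ∧ q j < q k) ∧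
        ¬ (matchingApprovers S W U j).card < (matchingApprovers S W U k).card}
  have hP : ∀ x, Tendsto (fun n => Measure.pi (fun _ : Fin n => ballotLaw q) (P n x))
      atTop (𝓝 0) := by
    rintro (j | ⟨W, U, j, k⟩)
    · exact tendsto_not_approvers_nonempty hq j
    · by_cases h : j ∉ W ∧ k ∉ W ∧ q j < q k
      · simpa [P, h] using tendsto_not_card_lt hq W U h.1 h.2.1 h.2.2
      · simp [P, h]
  have hsum : Tendsto (fun n => ∑ x, Measure.pi (fun _ : Fin n => ballotLaw q) (P n x))
      atTop (𝓝 0) := by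
    simpa using tendsto_finsetSum Finset.univ fun x _ => hP x
  refine tendsto_of_tendsto_of_tendsto_of_le_of_le tendsto_const_nhds hsum (fun _ => zero_le)
    fun n => (measure_mono fun S hS => ?_).trans (measure_iUnion_fintype_le _ (P n))
  by_contra hnot
  simp only [Set.mem_iUnion, not_exists] at hnot
  refine hS ⟨fun j => ?_, fun W U j k hj hk hjk => ?_⟩
  · by_contra h
    exact hnot (.inl j) h
  · by_contra h
    exact hnot (.inr (W, U, j, k)) ⟨⟨hj, hk, hjk⟩, h⟩

end Probability

/-! ### Optimality and performance -/

namespace Environment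

variable {A : Type*} (I : Environment A)

theorem value_of_unit (hc : ∀ j, I.cost j = 1) (L : I.QualityVector) (W : Finset A) :
    I.value L W = ∑ j ∈ W, ((L j : ℕ) : ℝ) := by
  unfold value
  cases I.utility <;> simp [hc]

variable [Fintype A]

theorem profileLaw_eq (L : I.QualityVector) (n : ℕ) :
    I.profileLaw L n = Measure.pi fun _ : Fin n => ballotLaw fun j => I.Q j (L j) := rfl

theorem isProbabilityMeasure_profileLaw (L : I.QualityVector) (n : ℕ) :
    IsProbabilityMeasure (I.profileLaw L n) := by
  have := isProbabilityMeasure_ballotLaw fun j => I.Q_mem j (L j)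
  rw [profileLaw_eq]
  infer_instance

/-- Compare `V \ W` with `W \ V`: the latter is at least as large, and by dominance none of its
members has lower quality than the best `a ∈ V \ W`, since otherwise upward closure would put `a` in
`W`. -/
theorem mem_optimalSets_of_isTop [DecidableEq A] (hc : ∀ j, I.cost j = 1) {k : ℕ}
    (hk : I.budget = k) (hdom : I.QualityDominant) (L : I.QualityVector) {W : Finset A}
    (hW : IsTop (fun j => I.Q j (L j)) Finset.univ k W) : W ∈ I.optimalSets L := by
  have hfeas : ∀ V, V ∈ I.feasible ↔ V.card ≤ k := by
    intro V
    simp [feasible, totalCost_of_unit hc, hk]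
  obtain ⟨⟨-, hup⟩, hcard⟩ := hW
  refine ⟨(hfeas W).2 (hcard ▸ min_le_right _ _), fun V hV => ?_⟩
  rw [hfeas] at hV
  rw [I.value_of_unit hc, I.value_of_unit hc, ← Finset.sum_sdiff_le_sum_sdiff]
  have hle : (V \ W).card ≤ (W \ V).card := by
    have h1 := Finset.card_sdiff_add_card_inter V W
    have h2 := Finset.card_sdiff_add_card_inter W V
    have h3 := Finset.card_le_univ V
    rw [Finset.inter_comm] at h2
    rw [Finset.card_univ] at hcard
    omega
  rcases (V \ W).eq_empty_or_nonempty with he | hne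
  · rw [he, Finset.sum_empty]
    exact Finset.sum_nonneg fun _ _ => Nat.cast_nonneg _
  obtain ⟨a, ha, hmax⟩ := (V \ W).exists_max_image (fun j => (L j : ℕ)) hne
  have hmin : ∀ j ∈ W \ V, (L a : ℕ) ≤ L j := by
    intro j hj
    by_contra! hlt
    exact (Finset.mem_sdiff.1 ha).2
      (hup j (Finset.mem_sdiff.1 hj).1 a (Finset.mem_univ a) (hdom a j _ _ hlt))
  have h : ∑ j ∈ V \ W, (L j : ℕ) ≤ ∑ j ∈ W \ V, (L j : ℕ) :=
    (Finset.sum_le_card_nsmul _ _ _ hmax).trans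
      ((Nat.mul_le_mul_right _ hle).trans (Finset.card_nsmul_le_sum _ _ _ hmin))
  exact_mod_cast h

variable {I}

theorem tendsto_not_mem_optimalSets [DecidableEq A] (hc : ∀ j, I.cost j = 1) {k : ℕ}
    (hk : I.budget = k) (hdom : I.QualityDominant) {r : VotingRule A}
    (hr : ∀ (q : A → ℝ) (n : ℕ) (S : Profile n A), IsRepresentative S q →
      IsTop q Finset.univ k (r n S I.cost Finset.univ k)) (L : I.QualityVector) :
    Tendsto (fun n : ℕ => I.profileLaw L n {S | I.outcome r S ∉ I.optimalSets L})
      atTop (𝓝 0) := by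
  refine tendsto_of_tendsto_of_tendsto_of_le_of_le tendsto_const_nhds
    (tendsto_not_isRepresentative fun j => I.Q_mem j (L j)) (fun _ => zero_le)
    fun n => measure_mono fun S hS hrep => hS ?_
  refine I.mem_optimalSets_of_isTop hc hk hdom L ?_
  rw [outcome, hk]
  exact hr _ n S hrep

theorem tendsto_mem_optimalSets {r : VotingRule A} {L : I.QualityVector}
    (h : Tendsto (fun n : ℕ => I.profileLaw L n {S | I.outcome r S ∉ I.optimalSets L})
      atTop (𝓝 0)) :
    Tendsto (fun n : ℕ => I.profileLaw L n {S | I.outcome r S ∈ I.optimalSets L})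
      atTop (𝓝 1) := by
  have heq : ∀ n : ℕ, I.profileLaw L n {S | I.outcome r S ∈ I.optimalSets L} =
      1 - I.profileLaw L n {S | I.outcome r S ∉ I.optimalSets L} := by
    intro n
    have := I.isProbabilityMeasure_profileLaw L n
    rw [← prob_compl_eq_one_sub MeasurableSet.of_discrete]
    congr 1
    ext S
    simp
  simp_rw [heq]
  simpa using ENNReal.Tendsto.sub tendsto_const_nhds h (.inl ENNReal.one_ne_top)

variable [Nonempty A]

theorem value_eq_optimalValue {L : I.QualityVector} {W : Finset A} (hW : W ∈ I.optimalSets L) :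
    I.value L W = I.optimalValue L :=
  le_antisymm (Finset.le_sup' _ hW.1) (Finset.sup'_le _ _ hW.2)

/-- The outcome takes finitely many values, so the error is at most a constant `C` times the
probability of a non-optimal outcome. -/
theorem tendsto_integral_value {r : VotingRule A} {L : I.QualityVector}
    (h : Tendsto (fun n : ℕ => I.profileLaw L n {S | I.outcome r S ∉ I.optimalSets L})
      atTop (𝓝 0)) :
    Tendsto (fun n : ℕ => ∫ S, I.value L (I.outcome r S) ∂I.profileLaw L n) atTop
      (𝓝 (I.optimalValue L)) := by
  obtain ⟨C, hC⟩ := (Set.finite_range fun W => |I.value L W - I.optimalValue L|).bddAbove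
  have hreal : Tendsto
      (fun n : ℕ => C * (I.profileLaw L n).real {S | I.outcome r S ∉ I.optimalSets L})
      atTop (𝓝 0) := by
    simpa [Measure.real] using ((ENNReal.tendsto_toReal ENNReal.zero_ne_top).comp h).const_mul C
  rw [tendsto_iff_norm_sub_tendsto_zero]
  refine squeeze_zero (fun _ => norm_nonneg _) (fun n => ?_) hreal
  have := I.isProbabilityMeasure_profileLaw L n
  have hsub : ∫ S, I.value L (I.outcome r S) ∂I.profileLaw L n - I.optimalValue L =
      ∫ S, (I.value L (I.outcome r S) - I.optimalValue L) ∂I.profileLaw L n := by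
    rw [integral_sub Integrable.of_finite (integrable_const _)]
    simp
  rw [hsub]
  refine (norm_integral_le_integral_norm _).trans ?_
  rw [mul_comm, ← smul_eq_mul, ← integral_indicator_const C MeasurableSet.of_discrete]
  refine integral_mono Integrable.of_finite Integrable.of_finite fun S => ?_
  by_cases hS : I.outcome r S ∈ I.optimalSets L
  · simp [hS, value_eq_optimalValue hS]
  · simpa [hS] using hC ⟨I.outcome r S, rfl⟩

theorem tendsto_performance {r : VotingRule A}
    (h : ∀ L : I.QualityVector,
      Tendsto (fun n : ℕ => I.profileLaw L n {S | I.outcome r S ∉ I.optimalSets L})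
        atTop (𝓝 0)) :
    Tendsto (fun n : ℕ => I.performance r n) atTop (𝓝 1) := by
  classical
  have hratio : ∀ L : I.QualityVector, Tendsto (fun n => I.ratio r n L) atTop (𝓝 1) := by
    intro L
    unfold ratio
    split_ifs with h0
    · exact tendsto_const_nhds
    · simpa [div_self h0] using (tendsto_integral_value (h L)).div_const (I.optimalValue L)
  -- The minimum over finitely many quality vectors commutes with the limit.
  simpa [performance] using Filter.Tendsto.finset_inf'_nhds_apply
    (Finset.univ_nonempty (α := I.QualityVector)) fun L _ => hratio L

end Environment

end EpistemicPB

theorem theorem1 {A : Type*} [Fintype A] [DecidableEq A] [Nonempty A]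
    (I : EpistemicPB.Environment A) (hunit : I.UnitCost) (hdom : I.QualityDominant)
    (τ τ' : EpistemicPB.TieBreaking A) (σ : EpistemicPB.TieBreaking (Finset A))
    (r : EpistemicPB.VotingRule A)
    (hr : r ∈ ({EpistemicPB.av τ,
                EpistemicPB.greedyCover τ,
                EpistemicPB.phragmen τ,
                EpistemicPB.mesThen τ (EpistemicPB.av τ'),
                EpistemicPB.mesThen τ (EpistemicPB.phragmen τ'),
                EpistemicPB.pav σ} : Set (EpistemicPB.VotingRule A))) :
    Tendsto (fun n : ℕ => I.performance r n) atTop (𝓝 1) ∧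
      ∀ L : I.QualityVector,
        Tendsto (fun n : ℕ => I.profileLaw L n {S | I.outcome r S ∈ I.optimalSets L})
          atTop (𝓝 1) := by
  obtain ⟨hc, k, hk⟩ := hunit
  have htop : ∀ (q : A → ℝ) (n : ℕ) (S : EpistemicPB.Profile n A),
      EpistemicPB.IsRepresentative S q →
        EpistemicPB.IsTop q Finset.univ k (r n S I.cost Finset.univ k) := by
    intro q n S hS
    rcases hr with rfl | rfl | rfl | rfl | rfl | rfl
    · exact EpistemicPB.isTop_av τ hS hc _ k
    · exact EpistemicPB.isTop_greedyCover τ hS hc _ k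
    · exact EpistemicPB.isTop_phragmen τ hS hc _ k
    · exact EpistemicPB.isTop_mesThen τ hS hc (EpistemicPB.isTop_av τ' hS hc) _ k
    · exact EpistemicPB.isTop_mesThen τ hS hc (EpistemicPB.isTop_phragmen τ' hS hc) _ k
    · exact EpistemicPB.isTop_pav σ hS hc _ k
  have h := fun L => EpistemicPB.Environment.tendsto_not_mem_optimalSets hc hk hdom htop L
  exact ⟨EpistemicPB.Environment.tendsto_performance h,
    fun L => EpistemicPB.Environment.tendsto_mem_optimalSets (h L)⟩
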